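/- Let $S$ be a Riemann surface with a holomorphic vector field $\partial$, and let $G$ be a connected (finite-dimensional) complex Lie group. Identify the Lie algebra $\mathcal R(G)$ of right-invariant vector fields on $G$ with $T_{\mathrm{Id}}G$. An automorphic system in $G$ depending on $S$ is a vector field on $S\times G$ of the form $$\vec A=\partial+\sum_{i=1}^s f_i(t)\,\vec A_i,\qquad f_i\in\mathcal O(S),\ \vec A_i\in\mathcal R(G).$$ Let $M$ be a $G$-homogeneous space (a complex manifold with a transitive holomorphic action of $G$), let $x_0\in M$, let $H$ be the isotropy subgroup of $x_0$, and let $H^0$ be the connected component of the identity of $H$. The induced Lie–Vessiot system is the vector field $\vec A^M=\partial+\sum_i f_i(t)\,\vec A_i^M$ on $S\times M$, where $\vec A_i^M$ is the fundamental vector field on $M$, with value at $y\in M$ the image of $(\vec A_i)_{\mathrm{Id}}$ under the differential at $\mathrm{Id}$ of $g\mapsto g\cdot y$. A solution of $\vec A^M$ on an open set $U\subset S$ is a holomorphic map $x\colon U\to M$ such that the differential of $t\mapsto (t,x(t))$ maps $\partial_t$ to $\vec A^M_{(t,x(t))}$ for all $t\in U$. Theorem (Lie's reduction method). Let $t_0\in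 S$, and let $x(t)$ be a solution of $\vec A^M$ defined on an open neighbourhood $U$ of $t_0$. Then there exist an open neighbourhood $S'\subset U$ of $t_0$ and a holomorphic map $\sigma\colon S'\to G$ with $\sigma(t)\cdot x(t)=x_0$ for all $t\in S'$, such that the gauge transformation $$L_\sigma\colon S'\times G\to S'\times G,\qquad (t,\tau)\mapsto (t,\sigma(t)\tau),$$ maps $\vec A|_{S'\times G}$ to an automorphic system in $H^0$, that is, to a vector field $$\vec B=\partial+\sum_{j=1}^{r} g_j(t)\,\vec B_j,\qquad g_j\in\mathcal O(S'),\ \vec B_j\in\mathcal R(H^0)\subset\mathcal R(G),$$ where $\mathcal R(H^0)$ is identified with the tangent space $T_{\mathrm{Id}}H^0\subset T_{\mathrm{Id}}G$. -/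

import Mathlib

open scoped Manifold ContDiff

noncomputable section

namespace LieVessiot

variable {S : Type*} [TopologicalSpace S] [ChartedSpace ℂ S]
  {E : Type*} [NormedAddCommGroup E] [NormedSpace ℂ E]
  {G : Type*} [TopologicalSpace G] [ChartedSpace E G] [Group G]
  {F : Type*} [NormedAddCommGroup F] [NormedSpace ℂ F]
  {M : Type*} [TopologicalSpace M] [ChartedSpace F M] [MulAction G M]

/-- The Lie algebra `R(G)` of right-invariant vector fields on `G`, identified with the tangent
space of `G` at the identity by evaluation there; see `rightInvariantField` for the vector field
attached to a tangent vector. -/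
abbrev RightAlgebra (E : Type*) [NormedAddCommGroup E] [NormedSpace ℂ E]
    (G : Type*) [TopologicalSpace G] [ChartedSpace E G] [Group G] : Type _ :=
  TangentSpace 𝓘(ℂ, E) (1 : G)

/-- The right-invariant vector field on `G` whose value at the identity is `v`: its value at `g` is
the image of `v` under the differential at `1` of the right translation `a ↦ a * g`. -/
def rightInvariantField (v : RightAlgebra E G) (g : G) : TangentSpace 𝓘(ℂ, E) g :=
  (mfderiv 𝓘(ℂ, E) 𝓘(ℂ, E) (fun a : G => a * g) 1 v : E)

/-- The fundamental vector field on the `G`-space `M` given by the right-invariant vector field with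
value `v` at the identity: its value at `x` is the image of `v` under the differential at `1` of the
orbit map `a ↦ a • x`. -/
def fundamentalField (F : Type*) [NormedAddCommGroup F] [NormedSpace ℂ F]
    {M : Type*} [TopologicalSpace M] [ChartedSpace F M] [MulAction G M]
    (v : RightAlgebra E G) (x : M) : TangentSpace 𝓘(ℂ, F) x :=
  (mfderiv 𝓘(ℂ, E) 𝓘(ℂ, F) (fun a : G => a • x) 1 v : F)

/-- A not necessarily autonomous vector field on `N` depending on the Riemann surface `S`: a vector
field on the extended phase space `S × N`. -/
abbrev ExtendedField (S : Type*) [TopologicalSpace S] [ChartedSpace ℂ S]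
    (F : Type*) [NormedAddCommGroup F] [NormedSpace ℂ F]
    (N : Type*) [TopologicalSpace N] [ChartedSpace F N] : Type _ :=
  (p : S × N) → TangentSpace (𝓘(ℂ, ℂ).prod 𝓘(ℂ, F)) p

/-- An automorphic system `∂ + ∑ i, f i (t) A i` in `G`, with time varying in the (open) part `S'`
of the Riemann surface: finitely many right-invariant vector fields `A i` on `G`, and coefficients
`f i` holomorphic on `S'`. Only the values of `f i` on `S'` matter. The derivation `∂` is fixed
separately, as a holomorphic vector field on the Riemann surface. -/
structure AutomorphicSystem (E : Type*) [NormedAddCommGroup E] [NormedSpace ℂ E]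
    (G : Type*) [TopologicalSpace G] [ChartedSpace E G] [Group G]
    {S : Type*} [TopologicalSpace S] [ChartedSpace ℂ S] (S' : Set S) where
  /-- the number of terms -/
  s : ℕ
  /-- the coefficients -/
  f : Fin s → S → ℂ
  /-- the right-invariant vector fields -/
  A : Fin s → RightAlgebra E G
  holomorphic : ∀ i, ContMDiffOn 𝓘(ℂ, ℂ) 𝓘(ℂ, ℂ) ω (f i) S'

/-- The vector field `∂ + ∑ i, f i (t) A i` on `S × G`. -/
def AutomorphicSystem.field {S' : Set S} (A : AutomorphicSystem E G S')
    (d : (t : S) → TangentSpace 𝓘(ℂ, ℂ) t) : ExtendedField S E G :=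
  fun p => ((d p.1, ∑ i, A.f i p.1 • rightInvariantField (A.A i) p.2) : ℂ × E)

/-- The Lie-Vessiot system `∂ + ∑ i, f i (t) (A i)^M` induced in the `G`-space `M`, a vector field
on `S × M`. -/
def AutomorphicSystem.inducedField {S' : Set S} (A : AutomorphicSystem E G S')
    (d : (t : S) → TangentSpace 𝓘(ℂ, ℂ) t)
    (F : Type*) [NormedAddCommGroup F] [NormedSpace ℂ F]
    (M : Type*) [TopologicalSpace M] [ChartedSpace F M] [MulAction G M] : ExtendedField S F M :=
  fun p => ((d p.1, ∑ i, A.f i p.1 • fundamentalField F (A.A i) p.2) : ℂ × F)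

/-- `x` is a solution, defined on the open set `U`, of the vector field `X` on `S × N`: it is
holomorphic on `U`, and its graph `t ↦ (t, x t)` carries `∂` to `X`. -/
def IsSolutionOn {N : Type*} [TopologicalSpace N] [ChartedSpace F N]
    (d : (t : S) → TangentSpace 𝓘(ℂ, ℂ) t) (X : ExtendedField S F N) (x : S → N)
    (U : Set S) : Prop :=
  ContMDiffOn 𝓘(ℂ, ℂ) 𝓘(ℂ, F) ω x U ∧
    ∀ t ∈ U, mfderiv 𝓘(ℂ, ℂ) (𝓘(ℂ, ℂ).prod 𝓘(ℂ, F)) (fun r : S => (r, x r)) t (d t) = X (t, x t)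

/-- The gauge transformation `(t, y) ↦ (t, σ t • y)` of `S × N`, for a `G`-space `N`. The group `G`
itself is a `G`-space by left translations, which gives `(t, τ) ↦ (t, σ t * τ)`. -/
def gaugeMap {N : Type*} [SMul G N] (σ : S → G) (p : S × N) : S × N :=
  (p.1, σ p.1 • p.2)

/-- The gauge transformation induced by `σ`, restricted to `S' × G`, maps the vector field `X` to
the vector field `Y`. -/
def GaugeMapsOn (σ : S → G) (S' : Set S) (X Y : ExtendedField S E G) : Prop :=
  ∀ p : S × G, p.1 ∈ S' →
    mfderiv (𝓘(ℂ, ℂ).prod 𝓘(ℂ, E)) (𝓘(ℂ, ℂ).prod 𝓘(ℂ, E)) (gaugeMap σ) p (X p) = Y (gaugeMap σ p)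

/-- The connected component `H⁰` of the identity of a subgroup `H` of `G`, as a subgroup of `G`. -/
def identityComponent {G : Type*} [TopologicalSpace G] [Group G] [IsTopologicalGroup G]
    (H : Subgroup G) : Subgroup G :=
  (Subgroup.connectedComponentOfOne H).map H.subtype

/-- The Lie algebra `R(K)` of a (closed complex Lie) subgroup `K` of `G`, inside `R(G)`: the tangent
vectors at the identity to `K`, that is, the velocities at `z = 0` of the germs of holomorphic
curves `z ↦ γ z` in `G` which lie in `K` and pass through the identity at `z = 0`. -/
def subgroupAlgebra (E : Type*) [NormedAddCommGroup E] [NormedSpace ℂ E]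
    {G : Type*} [TopologicalSpace G] [ChartedSpace E G] [Group G] (K : Subgroup G) :
    Set (RightAlgebra E G) :=
  {v | ∃ γ : ℂ → G, ContMDiffAt 𝓘(ℂ, ℂ) 𝓘(ℂ, E) ω γ 0 ∧ γ 0 = 1 ∧
    (∀ᶠ z in nhds (0 : ℂ), γ z ∈ K) ∧ (mfderiv 𝓘(ℂ, ℂ) 𝓘(ℂ, E) γ 0 (1 : ℂ) : E) = v}

/-- The automorphic system `∂ + ∑ i, f i (t) A i` in `G` is an automorphic system in the subgroup
`K`: every `A i` belongs to `R(K)`. -/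
def AutomorphicSystem.IsIn {S' : Set S} (A : AutomorphicSystem E G S') (K : Subgroup G) : Prop :=
  ∀ i, A.A i ∈ subgroupAlgebra E K

end LieVessiot

end

/-!
Let `π : G → M`, `g ↦ g • x₀` be the orbit map. Everything rests on `π` being a submersion
(`surjective_modelDeriv_orbitMap`). Since `π` intertwines left translations with the action, its
rank is constant. Since `G` is connected and locally compact, it is `σ`-compact, so that the open
mapping theorem for transitive actions (a Baire category argument) applies and `π` is open. A map of
constant rank which is not a submersion sends a small open set into the graph of a function over a
proper subspace, which has empty interior; so an open map of constant rank is a submersion.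

A submersion has holomorphic local sections, and every vector killed by its derivative is the
velocity of a holomorphic curve in the fibre. A section `s` of `π` near `x t₀` gives the gauge
transformation `σ t = (s (x t))⁻¹`, for which `σ t • x t = x₀`. Curves in the fibre `π⁻¹(x₀)`, the
isotropy subgroup `H` of `x₀`, show that `ker dπ₁` is contained in the Lie algebra of `H⁰`.

The gauge transformation takes the automorphic system with coefficient `a : S → T₁G` to the one with
coefficient `b = (∂σ) σ⁻¹ + Ad_σ a` (`modelDeriv_gaugeMap`). Differentiating `σ t • x t = x₀` gives
`dπ₁ (b t) = 0` (`modelDeriv_orbitMap_gaugeTransform_eq_zero`). The coordinates of the holomorphic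
function `b` in a basis of `ker dπ₁` are the coefficients of the reduced system.
-/

noncomputable section

namespace LieVessiot

open scoped Topology

/-! ### Maps with surjective derivative and maps of constant rank between vector spaces -/

section Calculus

variable {E : Type*} [NormedAddCommGroup E] [NormedSpace ℂ E] [FiniteDimensional ℂ E]
  {F : Type*} [NormedAddCommGroup F] [NormedSpace ℂ F] [FiniteDimensional ℂ F]

/-- A map whose derivative at `a` is onto becomes the projection `F × ker L → F` after a change of
coordinates at the source: `x ↦ (f x, q x)`, for a projection `q` onto `ker L`, is invertible near
`a` by the inverse function theorem, and `Ψ` is its inverse. -/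
theorem exists_straightening {n : ℕ∞ω} (hn : n ≠ 0) {f : E → F} {a : E} {L : E →L[ℂ] F}
    (hf : ContDiffAt ℂ n f a) (hL : HasFDerivAt f L a) (hsurj : Function.Surjective L) :
    ∃ (q : E →L[ℂ] L.ker) (Ψ : F × L.ker → E),
      ContDiffAt ℂ n Ψ (f a, q a) ∧ Ψ (f a, q a) = a ∧
      (∀ᶠ x in 𝓝 a, Ψ (f x, q x) = x) ∧
      (∀ᶠ u in 𝓝 (f a, q a), f (Ψ u) = u.1 ∧ q (Ψ u) = u.2) ∧
      ∀ v : L.ker, fderiv ℂ Ψ (f a, q a) (0, v) = v := by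
  have := FiniteDimensional.complete ℂ E
  obtain ⟨q, hq⟩ : ∃ q : E →L[ℂ] L.ker, ∀ v : L.ker, q v = v := by
    obtain ⟨q, hq⟩ := LinearMap.exists_leftInverse_of_injective L.ker.subtype
      (Submodule.ker_subtype _)
    exact ⟨LinearMap.toContinuousLinearMap q, fun v => by
      simpa using LinearMap.congr_fun hq v⟩
  have hcompl : IsCompl L.ker q.ker := LinearMap.isCompl_of_proj hq
  let Φ' : E ≃L[ℂ] F × L.ker := ContinuousLinearMap.equivProdOfSurjectiveOfIsCompl L q
    (LinearMap.range_eq_top.2 hsurj) (LinearMap.range_eq_top.2 fun v => ⟨v, hq v⟩) hcompl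
  have hΦ : ContDiffAt ℂ n (fun x => (f x, q x)) a := hf.prodMk q.contDiff.contDiffAt
  have hΦ' : HasFDerivAt (fun x => (f x, q x)) (Φ' : E →L[ℂ] F × L.ker) a :=
    hL.prodMk q.hasFDerivAt
  have hs := hΦ.hasStrictFDerivAt' hΦ' hn
  have hΨ' : HasFDerivAt (hΦ.localInverse hΦ' hn) (Φ'.symm : F × L.ker →L[ℂ] E) (f a, q a) :=
    hs.to_localInverse.hasFDerivAt
  refine ⟨q, hΦ.localInverse hΦ' hn, hΦ.to_localInverse hΦ' hn,
    hΦ.localInverse_apply_image hΦ' hn, hs.eventually_left_inverse, ?_, fun v => ?_⟩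
  · filter_upwards [hs.eventually_right_inverse] with u hu
    exact ⟨congrArg Prod.fst hu, congrArg Prod.snd hu⟩
  · rw [hΨ'.fderiv]
    have : ((0 : F), v) = Φ' v := by
      refine Prod.ext ?_ ?_
      · exact v.2.symm
      · exact (hq v).symm
    rw [this]
    exact Φ'.symm_apply_apply _

/-- If the derivative of `f` has constant rank near `a` and `f` maps every neighbourhood of `a` to a
neighbourhood of `f a`, then this derivative is onto: otherwise, by constancy of the rank, `f` maps
a neighbourhood of `a` into the graph of a function over the proper subspace `range f'(a)`. -/
theorem surjective_fderiv_of_finrank_eventually_eq {f : E → F} {a : E}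
    (hf : ContDiffAt ℂ 1 f a)
    (hrank : ∀ᶠ x in 𝓝 a, Module.finrank ℂ (fderiv ℂ f x).range =
      Module.finrank ℂ (fderiv ℂ f a).range)
    (hopen : 𝓝 (f a) ≤ Filter.map f (𝓝 a)) :
    Function.Surjective (fderiv ℂ f a) := by
  by_contra hns
  set L := fderiv ℂ f a
  let W := L.range
  obtain ⟨P, hP⟩ : ∃ P : F →L[ℂ] W, ∀ w : W, P w = w := by
    obtain ⟨q, hq⟩ := LinearMap.exists_leftInverse_of_injective W.subtype
      (Submodule.ker_subtype _)
    exact ⟨LinearMap.toContinuousLinearMap q, fun v => by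
      simpa using LinearMap.congr_fun hq v⟩
  -- a direction transverse to the range of the derivative
  obtain ⟨c, hcP, hc⟩ : ∃ c : F, P c = 0 ∧ c ≠ 0 := by
    obtain ⟨y, hy⟩ : ∃ y : F, y ∉ W := by
      by_contra! h
      exact hns fun y => h y
    refine ⟨y - P y, by rw [map_sub, hP, sub_self], fun h => hy ?_⟩
    rw [sub_eq_zero.1 h]
    exact (P y).2
  have hfd : HasFDerivAt f L a := (hf.differentiableAt one_ne_zero).hasFDerivAt
  have hPL : Function.Surjective (P ∘L L) := fun w => by
    obtain ⟨x, hx⟩ := w.2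
    refine ⟨x, ?_⟩
    change P (L x) = w
    rw [← hP w]
    exact congrArg P hx
  -- `P ∘ f` has a surjective derivative at `a`; in the coordinates `Ψ` it is the first projection
  obtain ⟨q, Ψ, hΨ, hΨa, hleft, hright, -⟩ := exists_straightening one_ne_zero
    (P.contDiff.contDiffAt.comp a hf) (P.hasFDerivAt.comp a hfd) hPL
  simp only [Function.comp_apply] at hΨ hΨa hleft hright
  have hΨc : Filter.Tendsto Ψ (𝓝 (P (f a), q a)) (𝓝 a) := by
    simpa only [hΨa] using hΨ.continuousAt.tendsto
  have hfd' : ∀ᶠ x in 𝓝 a, DifferentiableAt ℂ f x :=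
    (hf.eventually (by simp)).mono fun x hx => hx.differentiableAt one_ne_zero
  have hall : ∀ᶠ u in 𝓝 (P (f a), q a), DifferentiableAt ℂ Ψ u ∧
      DifferentiableAt ℂ f (Ψ u) ∧
      Module.finrank ℂ (fderiv ℂ f (Ψ u)).range = Module.finrank ℂ W ∧
      ∀ᶠ u' in 𝓝 u, P (f (Ψ u')) = u'.1 := by
    filter_upwards [(hΨ.eventually (by simp)).mono fun x hx => hx.differentiableAt one_ne_zero,
      hΨc.eventually hfd', hΨc.eventually hrank, hright.eventually_nhds] with u h1 h2 h3 h4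
    exact ⟨h1, h2, h3, h4.mono fun u' h => h.1⟩
  obtain ⟨r, hr, hball⟩ := Metric.eventually_nhds_iff_ball.1 hall
  -- along the slice through the base point, `f ∘ Ψ` is constant
  have hconst : ∀ k ∈ Metric.ball (q a) r, f (Ψ (P (f a), k)) = f a := by
    have hmem : ∀ k ∈ Metric.ball (q a) r, (P (f a), k) ∈ Metric.ball (P (f a), q a) r := by
      intro k hk
      rw [← ball_prod_same]
      exact ⟨Metric.mem_ball_self hr, hk⟩
    have hder : ∀ k ∈ Metric.ball (q a) r,
        HasFDerivAt (fun k => f (Ψ (P (f a), k))) (0 : _ →L[ℂ] F) k := by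
      intro k hk
      obtain ⟨h1, h2, h3, h4⟩ := hball _ (hmem k hk)
      have hfΨ := h2.hasFDerivAt.comp _ h1.hasFDerivAt
      have hPfΨ : P ∘L (fderiv ℂ f (Ψ (P (f a), k)) ∘L fderiv ℂ Ψ (P (f a), k)) =
          ContinuousLinearMap.fst ℂ W _ := by
        have e1 := P.hasFDerivAt.comp (P (f a), k) hfΨ
        exact e1.unique (hasFDerivAt_fst.congr_of_eventuallyEq h4)
      have hcomp := hfΨ.comp k (hasFDerivAt_prodMk_right (𝕜 := ℂ) (P (f a)) k)
      convert! hcomp using 1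
      ext κ
      set D := fderiv ℂ f (Ψ (P (f a), k))
      set T := fderiv ℂ Ψ (P (f a), k)
      -- `P` maps the range of the derivative onto `W`, hence injectively since the ranks agree
      have hPs : Function.Surjective ((P : F →ₗ[ℂ] W) ∘ₗ D.range.subtype) := fun w =>
        ⟨⟨D (T (w, 0)), ⟨_, rfl⟩⟩, DFunLike.congr_fun hPfΨ (w, 0)⟩
      have hPi := (LinearMap.injective_iff_surjective_of_finrank_eq_finrank h3).2 hPs
      have h0 : (⟨D (T (0, κ)), ⟨_, rfl⟩⟩ : D.range) = 0 := by
        apply hPi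
        rw [map_zero]
        exact DFunLike.congr_fun hPfΨ (0, κ)
      exact (congrArg Subtype.val h0).symm
    intro k hk
    have := (convex_ball (q a) r).is_const_of_fderivWithin_eq_zero (𝕜 := ℂ)
      (fun k hk => (hder k hk).differentiableAt.differentiableWithinAt)
      (fun k hk => by
        rw [fderivWithin_of_isOpen Metric.isOpen_ball hk, (hder k hk).fderiv])
      hk (Metric.mem_ball_self hr)
    rw [this, hΨa]
  have hV : {x | Ψ (P (f x), q x) = x ∧ q x ∈ Metric.ball (q a) r} ∈ 𝓝 a :=
    hleft.and (q.continuous.continuousAt.eventually (Metric.ball_mem_nhds _ hr))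
  -- `f a + z • c` with `z ≠ 0` is not the image of a point near `a`: such a point would lie in the
  -- slice through `a`, because `P c = 0`
  have himg := hopen (Filter.image_mem_map hV)
  have hlim : Filter.Tendsto (fun z : ℂ => f a + z • c) (𝓝[≠] 0) (𝓝 (f a)) := by
    have : Continuous fun z : ℂ => f a + z • c := by fun_prop
    simpa using (this.tendsto 0).mono_left nhdsWithin_le_nhds
  obtain ⟨z, ⟨x, ⟨hx1, hx2⟩, hx⟩, hz⟩ :=
    ((hlim.eventually himg).and self_mem_nhdsWithin).exists
  have hPx : P (f x) = P (f a) := by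
    rw [hx, map_add, map_smul, hcP, smul_zero, add_zero]
  rw [hPx] at hx1
  have hfx := hconst _ hx2
  rw [hx1, hx] at hfx
  have : z • c = 0 := by simpa using hfx
  rcases smul_eq_zero.1 this with h | h
  · exact hz h
  · exact hc h

end Calculus

/-! ### Derivatives as maps between the model spaces -/

section ModelDeriv

variable {E₁ E₂ E₃ : Type*} [NormedAddCommGroup E₁] [NormedSpace ℂ E₁]
  [NormedAddCommGroup E₂] [NormedSpace ℂ E₂] [NormedAddCommGroup E₃] [NormedSpace ℂ E₃]
  {H₁ H₂ H₃ : Type*} [TopologicalSpace H₁] [TopologicalSpace H₂] [TopologicalSpace H₃]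
  (I₁ : ModelWithCorners ℂ E₁ H₁) (I₂ : ModelWithCorners ℂ E₂ H₂) (I₃ : ModelWithCorners ℂ E₃ H₃)
  {M₁ M₂ M₃ : Type*} [TopologicalSpace M₁] [ChartedSpace H₁ M₁]
  [TopologicalSpace M₂] [ChartedSpace H₂ M₂] [TopologicalSpace M₃] [ChartedSpace H₃ M₃]

/-- The derivative of `f` at `p`, as a map between the model spaces, with which the tangent spaces
are definitionally equal: sums and scalar multiples of its values are then formed in one fixed
space, whatever the base points. -/
def modelDeriv (f : M₁ → M₂) (p : M₁) : E₁ →L[ℂ] E₂ :=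
  mfderiv I₁ I₂ f p

variable {I₁ I₂ I₃}

theorem modelDeriv_comp {g : M₂ → M₃} {f : M₁ → M₂} {p : M₁}
    (hg : MDifferentiableAt I₂ I₃ g (f p)) (hf : MDifferentiableAt I₁ I₂ f p) :
    modelDeriv I₁ I₃ (g ∘ f) p = modelDeriv I₂ I₃ g (f p) ∘L modelDeriv I₁ I₂ f p :=
  mfderiv_comp p hg hf

theorem modelDeriv_comp_apply {g : M₂ → M₃} {f : M₁ → M₂} {p : M₁} {q : M₂}
    (hg : MDifferentiableAt I₂ I₃ g q) (hf : MDifferentiableAt I₁ I₂ f p) (hq : f p = q) (v : E₁) :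
    modelDeriv I₁ I₃ (fun x => g (f x)) p v =
      modelDeriv I₂ I₃ g q (modelDeriv I₁ I₂ f p v) := by
  subst hq
  exact DFunLike.congr_fun (modelDeriv_comp hg hf) v

theorem modelDeriv_eq_fderiv (f : E₁ → E₂) (x : E₁) :
    modelDeriv 𝓘(ℂ, E₁) 𝓘(ℂ, E₂) f x = fderiv ℂ f x :=
  mfderiv_eq_fderiv

/-- The Leibniz rule for a function of two variables restricted to the diagonal. -/
theorem modelDeriv_diag_apply {f : M₁ → M₂ → M₃} {g : M₁ → M₂} {p : M₁}
    (hf : MDifferentiableAt (I₁.prod I₂) I₃ (Function.uncurry f) (p, g p))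
    (hg : MDifferentiableAt I₁ I₂ g p) (v : E₁) :
    modelDeriv I₁ I₃ (fun x => f x (g x)) p v =
      modelDeriv I₁ I₃ (fun x => f x (g p)) p v +
        modelDeriv I₂ I₃ (f p) (g p) (modelDeriv I₁ I₂ g p v) := by
  have h1 : MDifferentiableAt I₁ (I₁.prod I₂) (fun x => (x, g x)) p :=
    mdifferentiableAt_id.prodMk hg
  have e1 : modelDeriv I₁ (I₁.prod I₂) (fun x => (x, g x)) p v = (v, modelDeriv I₁ I₂ g p v) := by
    have := mfderiv_prodMk (I := I₁) (I' := I₁) (I'' := I₂) mdifferentiableAt_id hg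
    have h2 := DFunLike.congr_fun this v
    refine h2.trans ?_
    change (mfderiv I₁ I₁ id p v, _) = _
    rw [mfderiv_id]
    rfl
  refine (modelDeriv_comp_apply (g := Function.uncurry f) (f := fun x => (x, g x)) hf h1 rfl
    v).trans ?_
  rw [e1]
  exact mfderiv_prod_eq_add_apply hf

end ModelDeriv

/-! ### Submersions -/

section Submersion

variable {E : Type*} [NormedAddCommGroup E] [NormedSpace ℂ E]
  {F : Type*} [NormedAddCommGroup F] [NormedSpace ℂ F]
  {M : Type*} [TopologicalSpace M] [ChartedSpace E M]
  {N : Type*} [TopologicalSpace N] [ChartedSpace F N]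

theorem contDiffAt_writtenInExtChartAt {n : ℕ∞ω} {f : M → N} {p : M}
    (hf : ContMDiffAt 𝓘(ℂ, E) 𝓘(ℂ, F) n f p) :
    ContDiffAt ℂ n (writtenInExtChartAt 𝓘(ℂ, E) 𝓘(ℂ, F) p f) (extChartAt 𝓘(ℂ, E) p p) := by
  have := (contMDiffAt_iff.1 hf).2
  simpa [writtenInExtChartAt, contDiffWithinAt_univ] using this

theorem hasFDerivAt_writtenInExtChartAt {f : M → N} {p : M}
    (hf : MDifferentiableAt 𝓘(ℂ, E) 𝓘(ℂ, F) f p) :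
    HasFDerivAt (writtenInExtChartAt 𝓘(ℂ, E) 𝓘(ℂ, F) p f)
      (modelDeriv 𝓘(ℂ, E) 𝓘(ℂ, F) f p) (extChartAt 𝓘(ℂ, E) p p) := by
  have h : HasFDerivWithinAt (writtenInExtChartAt 𝓘(ℂ, E) 𝓘(ℂ, F) p f)
    (modelDeriv 𝓘(ℂ, E) 𝓘(ℂ, F) f p)
    (Set.range 𝓘(ℂ, E)) (extChartAt 𝓘(ℂ, E) p p) := hf.hasMFDerivAt.2
  rwa [modelWithCornersSelf_coe, Set.range_id, hasFDerivWithinAt_univ] at h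

theorem writtenInExtChartAt_self {f : M → N} {p : M} :
    writtenInExtChartAt 𝓘(ℂ, E) 𝓘(ℂ, F) p f (extChartAt 𝓘(ℂ, E) p p) =
      extChartAt 𝓘(ℂ, F) (f p) (f p) := by
  simp [writtenInExtChartAt]

theorem finrank_range_comp_comp_of_isInvertible {E' F' : Type*}
    [NormedAddCommGroup E'] [NormedSpace ℂ E'] [NormedAddCommGroup F'] [NormedSpace ℂ F']
    {A : F →L[ℂ] F'} {B : E' →L[ℂ] E} (hA : A.IsInvertible) (hB : B.IsInvertible)
    (D : E →L[ℂ] F) :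
    Module.finrank ℂ (A ∘L D ∘L B).range = Module.finrank ℂ D.range := by
  obtain ⟨A, rfl⟩ := hA
  obtain ⟨B, rfl⟩ := hB
  have : ((A : F →L[ℂ] F') ∘L D ∘L (B : E' →L[ℂ] E)).range =
      D.range.map (A.toLinearEquiv : F →ₗ[ℂ] F') := by
    ext y
    constructor
    · rintro ⟨x, rfl⟩
      exact ⟨D (B x), ⟨_, rfl⟩, rfl⟩
    · rintro ⟨_, ⟨x, rfl⟩, rfl⟩
      exact ⟨B.symm x, by simp⟩
  rw [this]
  exact LinearEquiv.finrank_map_eq A.toLinearEquiv _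

variable [FiniteDimensional ℂ E] [FiniteDimensional ℂ F]

/-- A map whose derivative at `p` is onto has a local section through `p`. -/
theorem exists_contMDiffAt_section [IsManifold 𝓘(ℂ, E) ω M] [IsManifold 𝓘(ℂ, F) ω N]
    {f : M → N} {p : M}
    (hf : ContMDiffAt 𝓘(ℂ, E) 𝓘(ℂ, F) ω f p)
    (hsurj : Function.Surjective (modelDeriv 𝓘(ℂ, E) 𝓘(ℂ, F) f p)) :
    ∃ s : N → M, ContMDiffAt 𝓘(ℂ, F) 𝓘(ℂ, E) ω s (f p) ∧ s (f p) = p ∧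
      ∀ᶠ y in 𝓝 (f p), f (s y) = y := by
  obtain ⟨q, Ψ, hΨ, hΨa, -, hright, -⟩ := exists_straightening (by simp)
    (contDiffAt_writtenInExtChartAt hf)
    (hasFDerivAt_writtenInExtChartAt (hf.mdifferentiableAt (by simp))) hsurj
  rw [writtenInExtChartAt_self] at hΨ hΨa hright
  set φ := extChartAt 𝓘(ℂ, E) p with hφ
  set ψ := extChartAt 𝓘(ℂ, F) (f p) with hψ
  let σ : F → E := fun y => Ψ (y, q (φ p))
  have hσ : ContDiffAt ℂ ω σ (ψ (f p)) :=
    hΨ.comp (ψ (f p)) (contDiffAt_id.prodMk contDiffAt_const)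
  have hψc : ContMDiffAt 𝓘(ℂ, F) 𝓘(ℂ, F) ω ψ (f p) := contMDiffAt_extChartAt
  have hσψ : ContMDiffAt 𝓘(ℂ, F) 𝓘(ℂ, E) ω (fun y => σ (ψ y)) (f p) :=
    hσ.contMDiffAt.comp (f p) hψc
  have hσp : σ (ψ (f p)) = φ p := hΨa
  have hsymm : ContMDiffAt 𝓘(ℂ, E) 𝓘(ℂ, E) ω φ.symm (φ p) :=
    (contMDiffOn_extChartAt_symm p).contMDiffAt (extChartAt_target_mem_nhds p)
  have hs : ContMDiffAt 𝓘(ℂ, F) 𝓘(ℂ, E) ω (fun y => φ.symm (σ (ψ y))) (f p) := by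
    refine ContMDiffAt.comp (f p) (g := φ.symm) ?_ hσψ
    rw [hσp]
    exact hsymm
  have hsp : φ.symm (σ (ψ (f p))) = p := by
    rw [hσp]
    exact extChartAt_to_inv p
  refine ⟨fun y => φ.symm (σ (ψ y)), hs, hsp, ?_⟩
  have hfs : ∀ᶠ y in 𝓝 (f p), f (φ.symm (σ (ψ y))) ∈ ψ.source := by
    have : ContinuousAt (fun y => f (φ.symm (σ (ψ y)))) (f p) :=
      ContinuousAt.comp (g := f) (by rw [hsp]; exact hf.continuousAt) hs.continuousAt
    refine this.eventually (p := fun y => y ∈ ψ.source) ?_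
    simp only [hsp]
    exact extChartAt_source_mem_nhds (f p)
  have hlim : Filter.Tendsto (fun y => (ψ y, q (φ p))) (𝓝 (f p)) (𝓝 (ψ (f p), q (φ p))) :=
    hψc.continuousAt.prodMk continuousAt_const
  filter_upwards [hfs, extChartAt_source_mem_nhds (I := 𝓘(ℂ, F)) (f p),
    hlim.eventually hright] with y h1 h2 h3
  exact ψ.injOn h1 h2 h3.1

/-- Every vector killed by a surjective derivative is the velocity of a curve in the fibre: in
coordinates straightening `f`, a straight line in the direction of `v`. -/
theorem exists_curve_in_fibre [IsManifold 𝓘(ℂ, E) ω M] [IsManifold 𝓘(ℂ, F) ω N]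
    {f : M → N} {p : M}
    (hf : ContMDiffAt 𝓘(ℂ, E) 𝓘(ℂ, F) ω f p)
    (hsurj : Function.Surjective (modelDeriv 𝓘(ℂ, E) 𝓘(ℂ, F) f p))
    (v : E) (hv : modelDeriv 𝓘(ℂ, E) 𝓘(ℂ, F) f p v = 0) :
    ∃ γ : ℂ → M, ContMDiffAt 𝓘(ℂ, ℂ) 𝓘(ℂ, E) ω γ 0 ∧ γ 0 = p ∧
      (∀ᶠ z in 𝓝 (0 : ℂ), f (γ z) = f p) ∧
      modelDeriv 𝓘(ℂ, ℂ) 𝓘(ℂ, E) γ 0 1 = v := by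
  obtain ⟨D, hDs, hDv, hD⟩ : ∃ D : E →L[ℂ] F, Function.Surjective D ∧ D v = 0 ∧
      HasFDerivAt (writtenInExtChartAt 𝓘(ℂ, E) 𝓘(ℂ, F) p f) D (extChartAt 𝓘(ℂ, E) p p) :=
    ⟨_, hsurj, hv, hasFDerivAt_writtenInExtChartAt (hf.mdifferentiableAt (by simp))⟩
  obtain ⟨q, Ψ, hΨ, hΨa, -, hright, hder⟩ := exists_straightening (by simp)
    (contDiffAt_writtenInExtChartAt hf) hD hDs
  rw [writtenInExtChartAt_self] at hΨ hΨa hright hder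
  set φ := extChartAt 𝓘(ℂ, E) p with hφ
  set ψ := extChartAt 𝓘(ℂ, F) (f p) with hψ
  let w : D.ker := ⟨v, hDv⟩
  let ℓ : ℂ → F × D.ker := fun z => (ψ (f p), q (φ p) + z • w)
  have hℓ0 : ℓ 0 = (ψ (f p), q (φ p)) := by simp [ℓ]
  have hℓ : ContDiff ℂ ω ℓ := by fun_prop
  have hℓ' : HasDerivAt ℓ (0, w) 0 :=
    (hasDerivAt_const 0 _).prodMk (by
      simpa using ((hasDerivAt_id (0 : ℂ)).smul_const w).const_add (q (φ p)))
  have hc : ContDiffAt ℂ ω (fun z => Ψ (ℓ z)) 0 :=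
    ContDiffAt.comp 0 (g := Ψ) (by rw [hℓ0]; exact hΨ) hℓ.contDiffAt
  have hc0 : Ψ (ℓ 0) = φ p := by rw [hℓ0, hΨa]
  have hc' : HasDerivAt (fun z => Ψ (ℓ z)) v 0 := by
    have h := (hΨ.differentiableAt (by simp)).hasFDerivAt
    rw [← hℓ0] at h
    have := h.comp_hasDerivAt 0 hℓ'
    rw [hℓ0, hder w] at this
    exact this
  have hsymm : ContMDiffAt 𝓘(ℂ, E) 𝓘(ℂ, E) ω φ.symm (φ p) :=
    (contMDiffOn_extChartAt_symm p).contMDiffAt (extChartAt_target_mem_nhds p)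
  have hγ : ContMDiffAt 𝓘(ℂ, ℂ) 𝓘(ℂ, E) ω (fun z => φ.symm (Ψ (ℓ z))) 0 := by
    refine ContMDiffAt.comp 0 (g := φ.symm) ?_ hc.contMDiffAt
    rw [hc0]
    exact hsymm
  have hγ0 : φ.symm (Ψ (ℓ 0)) = p := by
    rw [hc0]
    exact extChartAt_to_inv p
  refine ⟨fun z => φ.symm (Ψ (ℓ z)), hγ, hγ0, ?_, ?_⟩
  · have hfs : ∀ᶠ z in 𝓝 (0 : ℂ), f (φ.symm (Ψ (ℓ z))) ∈ ψ.source := by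
      have : ContinuousAt (fun z => f (φ.symm (Ψ (ℓ z)))) 0 :=
        ContinuousAt.comp (g := f) (by rw [hγ0]; exact hf.continuousAt) hγ.continuousAt
      refine this.eventually (p := fun y => y ∈ ψ.source) ?_
      simp only [hγ0]
      exact extChartAt_source_mem_nhds (f p)
    have hlim : Filter.Tendsto ℓ (𝓝 0) (𝓝 (ψ (f p), q (φ p))) := by
      rw [← hℓ0]
      exact hℓ.continuous.continuousAt
    filter_upwards [hfs, hlim.eventually hright] with z h1 h2
    exact ψ.injOn h1 (mem_extChartAt_source (f p)) h2.1
  · have htgt : ∀ᶠ z in 𝓝 (0 : ℂ), Ψ (ℓ z) ∈ φ.target := by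
      refine hc.continuousAt.eventually (p := fun y => y ∈ φ.target) ?_
      simp only [hc0]
      exact extChartAt_target_mem_nhds p
    have h := hasFDerivAt_writtenInExtChartAt (hγ.mdifferentiableAt (by simp))
    have h' : HasFDerivAt (fun z => Ψ (ℓ z))
        (modelDeriv 𝓘(ℂ, ℂ) 𝓘(ℂ, E) (fun z => φ.symm (Ψ (ℓ z))) 0) 0 := by
      refine HasFDerivAt.congr_of_eventuallyEq h ?_
      filter_upwards [htgt] with z hz
      simp only [writtenInExtChartAt, Function.comp_def, hγ0]
      exact (φ.right_inv hz).symm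
    exact h'.hasDerivAt.unique hc'

/-- A map of locally constant rank which is open at `p` is a submersion at `p`. -/
theorem surjective_modelDeriv_of_finrank_eventually_eq [IsManifold 𝓘(ℂ, E) 1 M]
    [IsManifold 𝓘(ℂ, F) 1 N] {f : M → N} {p : M}
    (hf : ContMDiffAt 𝓘(ℂ, E) 𝓘(ℂ, F) 1 f p)
    (hrank : ∀ᶠ x in 𝓝 p, Module.finrank ℂ (modelDeriv 𝓘(ℂ, E) 𝓘(ℂ, F) f x).range =
      Module.finrank ℂ (modelDeriv 𝓘(ℂ, E) 𝓘(ℂ, F) f p).range)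
    (hopen : 𝓝 (f p) ≤ Filter.map f (𝓝 p)) :
    Function.Surjective (modelDeriv 𝓘(ℂ, E) 𝓘(ℂ, F) f p) := by
  have hfd := hasFDerivAt_writtenInExtChartAt (hf.mdifferentiableAt one_ne_zero)
  have key := surjective_fderiv_of_finrank_eventually_eq (contDiffAt_writtenInExtChartAt hf) ?_ ?_
  · rwa [hfd.fderiv] at key
  · rw [hfd.fderiv]
    set φ := extChartAt 𝓘(ℂ, E) p with hφ
    set ψ := extChartAt 𝓘(ℂ, F) (f p) with hψ
    have hsymm : Filter.Tendsto φ.symm (𝓝 (φ p)) (𝓝 p) := by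
      have := continuousAt_extChartAt_symm (I := 𝓘(ℂ, E)) p
      rwa [ContinuousAt, extChartAt_to_inv] at this
    have hfs : ∀ᶠ x in 𝓝 p, f x ∈ ψ.source :=
      hf.continuousAt.eventually (extChartAt_source_mem_nhds (f p))
    have hfd' : ∀ᶠ x in 𝓝 p, MDifferentiableAt 𝓘(ℂ, E) 𝓘(ℂ, F) f x :=
      ((contMDiffAt_iff_contMDiffAt_nhds (by simp)).1 hf).mono
        fun x hx => hx.mdifferentiableAt one_ne_zero
    filter_upwards [extChartAt_target_mem_nhds (I := 𝓘(ℂ, E)) p, hsymm.eventually hfs,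
      hsymm.eventually hfd', hsymm.eventually hrank] with x h1 h2 h3 h4
    have hA : (modelDeriv 𝓘(ℂ, F) 𝓘(ℂ, F) ψ (f (φ.symm x))).IsInvertible :=
      isInvertible_mfderiv_extChartAt h2
    have hB : (modelDeriv 𝓘(ℂ, E) 𝓘(ℂ, E) φ.symm x).IsInvertible := by
      have := isInvertible_mfderivWithin_extChartAt_symm (I := 𝓘(ℂ, E)) h1
      rwa [modelWithCornersSelf_coe, Set.range_id, mfderivWithin_univ] at this
    have dB : MDifferentiableAt 𝓘(ℂ, E) 𝓘(ℂ, E) φ.symm x := by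
      have := mdifferentiableWithinAt_extChartAt_symm (I := 𝓘(ℂ, E)) h1
      rwa [modelWithCornersSelf_coe, Set.range_id, mdifferentiableWithinAt_univ] at this
    have dA : MDifferentiableAt 𝓘(ℂ, F) 𝓘(ℂ, F) ψ (f (φ.symm x)) :=
      mdifferentiableAt_extChartAt (by simpa [hψ] using h2)
    have hcomp : fderiv ℂ (writtenInExtChartAt 𝓘(ℂ, E) 𝓘(ℂ, F) p f) x =
        modelDeriv 𝓘(ℂ, F) 𝓘(ℂ, F) ψ (f (φ.symm x)) ∘L
          modelDeriv 𝓘(ℂ, E) 𝓘(ℂ, F) f (φ.symm x) ∘L modelDeriv 𝓘(ℂ, E) 𝓘(ℂ, E) φ.symm x := by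
      rw [← modelDeriv_comp h3 dB, ← modelDeriv_eq_fderiv]
      exact modelDeriv_comp dA (h3.comp x dB)
    rw [← h4, hcomp]
    exact finrank_range_comp_comp_of_isInvertible hA hB _
  · rw [writtenInExtChartAt_self, writtenInExtChartAt, ← Filter.map_map, ← Filter.map_map]
    have h1 : Filter.map (extChartAt 𝓘(ℂ, E) p).symm (𝓝 (extChartAt 𝓘(ℂ, E) p p)) = 𝓝 p := by
      have := map_extChartAt_symm_nhdsWithin_range (I := 𝓘(ℂ, E)) p
      simpa using this
    have h2 : Filter.map (extChartAt 𝓘(ℂ, F) (f p)) (𝓝 (f p)) =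
        𝓝 (extChartAt 𝓘(ℂ, F) (f p) (f p)) := by
      have := map_extChartAt_nhds (I := 𝓘(ℂ, F)) (f p)
      simpa using this
    rw [h1, ← h2]
    exact Filter.map_mono hopen

end Submersion

/-! ### Orbit maps of transitive actions -/

open scoped Pointwise in
/-- A connected locally compact group is generated by a compact neighbourhood of the identity, and
is therefore a countable union of compact sets. -/
theorem sigmaCompactSpace_of_connectedSpace (G : Type*) [TopologicalSpace G] [Group G]
    [IsTopologicalGroup G] [ConnectedSpace G] [LocallyCompactSpace G] : SigmaCompactSpace G := by
  obtain ⟨K, hK, hK1⟩ := exists_compact_mem_nhds (1 : G)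
  have htop : Subgroup.closure K = ⊤ := by
    have hopen : IsOpen (Subgroup.closure K : Set G) :=
      Subgroup.isOpen_of_mem_nhds _ (Filter.mem_of_superset hK1 Subgroup.subset_closure)
    have hclopen : IsClopen (Subgroup.closure K : Set G) :=
      ⟨Subgroup.isClosed_of_isOpen _ hopen, hopen⟩
    exact SetLike.coe_injective (hclopen.eq_univ ⟨1, one_mem _⟩)
  refine ⟨fun n => (K ∪ K⁻¹) ^ n, fun n => ?_, Set.eq_univ_of_forall fun g => ?_⟩
  · induction n with
    | zero => simp
    | succ n ih => simp only [pow_succ]; exact ih.mul (hK.union hK.inv)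
  · have hg : g ∈ Subgroup.closure K := htop ▸ Subgroup.mem_top g
    induction hg using Subgroup.closure_induction_right with
    | one => exact Set.mem_iUnion.2 ⟨0, by simp⟩
    | mul_right x hx y hy ih =>
      obtain ⟨n, hn⟩ := Set.mem_iUnion.1 ih
      exact Set.mem_iUnion.2 ⟨n + 1, by
        rw [pow_succ]; exact Set.mul_mem_mul hn (Or.inl hy)⟩
    | mul_inv_cancel x hx y hy ih =>
      obtain ⟨n, hn⟩ := Set.mem_iUnion.1 ih
      exact Set.mem_iUnion.2 ⟨n + 1, by
        rw [pow_succ]; exact Set.mul_mem_mul hn (Or.inr (by simpa using hy))⟩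

section HomogeneousSpace

variable {E : Type*} [NormedAddCommGroup E] [NormedSpace ℂ E]
  {G : Type*} [TopologicalSpace G] [ChartedSpace E G] [Group G]
  {F : Type*} [NormedAddCommGroup F] [NormedSpace ℂ F]
  {M : Type*} [TopologicalSpace M] [ChartedSpace F M]
  [MulAction G M] [ContMDiffSMul 𝓘(ℂ, E) 𝓘(ℂ, F) ω G M]

theorem contMDiff_orbitMap (x : M) : ContMDiff 𝓘(ℂ, E) 𝓘(ℂ, F) ω fun g : G => g • x :=
  ContMDiff.smul (I := 𝓘(ℂ, E)) contMDiff_id contMDiff_const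

theorem mdifferentiableAt_orbitMap (x : M) (g : G) :
    MDifferentiableAt 𝓘(ℂ, E) 𝓘(ℂ, F) (fun g : G => g • x) g :=
  ((contMDiff_orbitMap x).mdifferentiable (by simp)) g

theorem mdifferentiableAt_smul_const (E : Type*) [NormedAddCommGroup E] [NormedSpace ℂ E]
    {G : Type*} [TopologicalSpace G] [ChartedSpace E G] [Group G]
    (F : Type*) [NormedAddCommGroup F] [NormedSpace ℂ F]
    {M : Type*} [TopologicalSpace M] [ChartedSpace F M]
    [MulAction G M] [ContMDiffSMul 𝓘(ℂ, E) 𝓘(ℂ, F) ω G M] (g : G) (x : M) :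
    MDifferentiableAt 𝓘(ℂ, F) 𝓘(ℂ, F) (fun y : M => g • y) x :=
  ((ContMDiffSMul.contMDiff_const_smul (I := 𝓘(ℂ, E)) (n := ω) g).mdifferentiable (by simp)) x

theorem isInvertible_modelDeriv_smul (E : Type*) [NormedAddCommGroup E] [NormedSpace ℂ E]
    {G : Type*} [TopologicalSpace G] [ChartedSpace E G] [Group G]
    (F : Type*) [NormedAddCommGroup F] [NormedSpace ℂ F]
    {M : Type*} [TopologicalSpace M] [ChartedSpace F M]
    [MulAction G M] [ContMDiffSMul 𝓘(ℂ, E) 𝓘(ℂ, F) ω G M] (g : G) (x : M) :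
    (modelDeriv 𝓘(ℂ, F) 𝓘(ℂ, F) (fun y : M => g • y) x).IsInvertible := by
  have key : ∀ (h : G) (y : M), modelDeriv 𝓘(ℂ, F) 𝓘(ℂ, F) (fun y : M => h⁻¹ • y) (h • y) ∘L
      modelDeriv 𝓘(ℂ, F) 𝓘(ℂ, F) (fun y : M => h • y) y = ContinuousLinearMap.id ℂ F := by
    intro h y
    rw [← modelDeriv_comp (mdifferentiableAt_smul_const E F _ _)
      (mdifferentiableAt_smul_const E F _ _)]
    have : (fun y : M => h⁻¹ • y) ∘ (fun y : M => h • y) = id := by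
      ext y; simp
    rw [this]
    exact mfderiv_id
  refine ContinuousLinearMap.IsInvertible.of_inverse
    (g := modelDeriv 𝓘(ℂ, F) 𝓘(ℂ, F) (fun y : M => g⁻¹ • y) (g • x)) ?_ (key g x)
  have := key g⁻¹ (g • x)
  simpa using this

variable [LieGroup 𝓘(ℂ, E) ω G]

/-- The orbit map intertwines left translations with the action, hence has constant rank. -/
theorem finrank_range_modelDeriv_orbitMap (x : M) (g : G) :
    Module.finrank ℂ (modelDeriv 𝓘(ℂ, E) 𝓘(ℂ, F) (fun a : G => a • x) g).range =
      Module.finrank ℂ (modelDeriv 𝓘(ℂ, E) 𝓘(ℂ, F) (fun a : G => a • x) 1).range := by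
  have h1 : (fun a : G => a • x) ∘ (fun a : G => g * a) =
      (fun y : M => g • y) ∘ fun a : G => a • x := by
    ext a; simp [mul_smul]
  have hL : MDifferentiableAt 𝓘(ℂ, E) 𝓘(ℂ, E) (fun a : G => g * a) 1 :=
    mdifferentiableAt_smul_const (M := G) E E g 1
  have h2 : modelDeriv 𝓘(ℂ, E) 𝓘(ℂ, F) ((fun a : G => a • x) ∘ fun a : G => g * a) 1 =
      modelDeriv 𝓘(ℂ, E) 𝓘(ℂ, F) ((fun y : M => g • y) ∘ fun a : G => a • x) 1 := by rw [h1]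
  rw [modelDeriv_comp (mdifferentiableAt_orbitMap _ _) hL,
    modelDeriv_comp (mdifferentiableAt_smul_const E F _ _) (mdifferentiableAt_orbitMap _ _),
    mul_one] at h2
  have i1 := isInvertible_modelDeriv_smul (M := G) E E g 1
  have i2 := isInvertible_modelDeriv_smul E F g ((1 : G) • x)
  have j1 := finrank_range_comp_comp_of_isInvertible
    (A := ContinuousLinearMap.id ℂ F) ⟨.refl ℂ F, rfl⟩ i1
    (modelDeriv 𝓘(ℂ, E) 𝓘(ℂ, F) (fun a : G => a • x) g)
  have j2 := finrank_range_comp_comp_of_isInvertible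
    (B := ContinuousLinearMap.id ℂ E) i2 ⟨.refl ℂ E, rfl⟩
    (modelDeriv 𝓘(ℂ, E) 𝓘(ℂ, F) (fun a : G => a • x) 1)
  rw [ContinuousLinearMap.id_comp] at j1
  rw [ContinuousLinearMap.comp_id] at j2
  rw [← j1, ← j2]
  exact congrArg (fun D : E →L[ℂ] F => Module.finrank ℂ D.range) h2

/-- The orbit map of a transitive action of a connected Lie group is a submersion: it has constant
rank, and it is open by the open mapping theorem for group actions. -/
theorem surjective_modelDeriv_orbitMap [FiniteDimensional ℂ E] [FiniteDimensional ℂ F]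
    [IsTopologicalGroup G] [ConnectedSpace G] [T2Space M]
    [IsManifold 𝓘(ℂ, F) ω M] [MulAction.IsPretransitive G M] (x : M) (g : G) :
    Function.Surjective (modelDeriv 𝓘(ℂ, E) 𝓘(ℂ, F) (fun a : G => a • x) g) := by
  have : ProperSpace E := FiniteDimensional.proper ℂ E
  have : ProperSpace F := FiniteDimensional.proper ℂ F
  have : LocallyCompactSpace G := ChartedSpace.locallyCompactSpace E G
  have : LocallyCompactSpace M := ChartedSpace.locallyCompactSpace F M
  have : SigmaCompactSpace G := sigmaCompactSpace_of_connectedSpace G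
  have : ContinuousSMul G M := ContMDiffSMul.continuousSMul (I := 𝓘(ℂ, E)) (I' := 𝓘(ℂ, F)) ω
  have : IsManifold 𝓘(ℂ, E) 1 G := IsManifold.of_le (n := ω) le_top
  have : IsManifold 𝓘(ℂ, F) 1 M := IsManifold.of_le (n := ω) le_top
  refine surjective_modelDeriv_of_finrank_eventually_eq
    ((contMDiff_orbitMap x).contMDiffAt.of_le le_top)
    (Filter.Eventually.of_forall fun a => ?_) ((isOpenMap_smul_of_sigmaCompact x).nhds_le g)
  rw [finrank_range_modelDeriv_orbitMap x a, finrank_range_modelDeriv_orbitMap x g]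

/-- If `γ` is continuous near `0`, starts at the identity and stays in `H` for small times, then it
stays in the identity component of `H` for small times. -/
theorem eventually_mem_identityComponent {G : Type*} [TopologicalSpace G] [Group G]
    [IsTopologicalGroup G] {H : Subgroup G} {γ : ℂ → G}
    (hγ : ∀ᶠ z in 𝓝 (0 : ℂ), ContinuousAt γ z) (h0 : γ 0 = 1) (hH : ∀ᶠ z in 𝓝 (0 : ℂ), γ z ∈ H) :
    ∀ᶠ z in 𝓝 (0 : ℂ), γ z ∈ identityComponent H := by
  obtain ⟨r, hr, hball⟩ := Metric.eventually_nhds_iff_ball.1 (hγ.and hH)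
  filter_upwards [Metric.ball_mem_nhds 0 hr] with z hz
  have hpre : IsPreconnected (γ '' Metric.ball 0 r) :=
    (convex_ball (0 : ℂ) r).isPreconnected.image _
      fun w hw => (hball w hw).1.continuousWithinAt
  have himg : H.subtype '' (H.subtype ⁻¹' (γ '' Metric.ball 0 r)) = γ '' Metric.ball 0 r := by
    rw [Set.image_preimage_eq_iff]
    rintro _ ⟨w, hw, rfl⟩
    exact ⟨⟨γ w, (hball w hw).2⟩, rfl⟩
  have hpre' : IsPreconnected (H.subtype ⁻¹' (γ '' Metric.ball 0 r)) := by
    rw [← himg] at hpre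
    exact (Topology.IsInducing.subtypeVal.isPreconnected_image).1 hpre
  refine ⟨⟨γ z, (hball z hz).2⟩, ?_, rfl⟩
  exact hpre'.subset_connectedComponent ⟨0, Metric.mem_ball_self hr, h0⟩ ⟨z, hz, rfl⟩

/-- A vector killed by the derivative of the orbit map of `x` is tangent to the identity component
of the isotropy subgroup of `x`. -/
theorem mem_subgroupAlgebra_identityComponent_stabilizer [FiniteDimensional ℂ E]
    [FiniteDimensional ℂ F] [IsTopologicalGroup G] [ConnectedSpace G] [T2Space M]
    [IsManifold 𝓘(ℂ, F) ω M] [MulAction.IsPretransitive G M] (x : M) {v : E}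
    (hv : modelDeriv 𝓘(ℂ, E) 𝓘(ℂ, F) (fun a : G => a • x) 1 v = 0) :
    v ∈ subgroupAlgebra E (identityComponent (MulAction.stabilizer G x)) := by
  obtain ⟨γ, hγ, hγ0, hfib, hder⟩ := exists_curve_in_fibre (contMDiff_orbitMap x).contMDiffAt
    (surjective_modelDeriv_orbitMap x (1 : G)) v hv
  refine ⟨γ, hγ, hγ0, eventually_mem_identityComponent ?_ hγ0 ?_, hder⟩
  · exact (((contMDiffAt_iff_contMDiffAt_nhds (by simp)).1 (hγ.of_le (m := 1) le_top))).mono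
      fun z hz => hz.continuousAt
  · filter_upwards [hfib] with z hz
    rw [MulAction.mem_stabilizer_iff, hz, one_smul]

end HomogeneousSpace

/-! ### Holomorphic dependence of derivatives on parameters -/

section Parametric

variable {E₁ E₂ E₃ : Type*} [NormedAddCommGroup E₁] [NormedSpace ℂ E₁]
  [NormedAddCommGroup E₂] [NormedSpace ℂ E₂] [NormedAddCommGroup E₃] [NormedSpace ℂ E₃]
  {H₁ H₂ H₃ : Type*} [TopologicalSpace H₁] [TopologicalSpace H₂] [TopologicalSpace H₃]
  {I₁ : ModelWithCorners ℂ E₁ H₁} {I₂ : ModelWithCorners ℂ E₂ H₂} {I₃ : ModelWithCorners ℂ E₃ H₃}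
  {M₁ M₂ M₃ : Type*} [TopologicalSpace M₁] [ChartedSpace H₁ M₁]
  [TopologicalSpace M₂] [ChartedSpace H₂ M₂] [TopologicalSpace M₃] [ChartedSpace H₃ M₃]

/-- The preferred trivialization of the tangent bundle at `p` is the identity on the fibre over
`p`. -/
theorem trivializationAt_apply_self [IsManifold I₁ 1 M₁] {p q : M₁} (hq : q = p)
    (w : TangentSpace I₁ q) :
    (trivializationAt E₁ (TangentSpace I₁) p (⟨q, w⟩ : TangentBundle I₁ M₁)).2 = w := by
  subst hq
  exact (tangentBundleCore I₁ M₁).coordChange_self (achart H₁ q) q (mem_achart_source H₁ q) w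

/-- The derivative at `g x` of maps `f x` sending `g x` to a fixed point `p`, applied to a vector
depending holomorphically on `x`, is a holomorphic function of `x` with values in the fixed tangent
space at `p`. -/
theorem contMDiffAt_modelDeriv_apply [IsManifold I₁ ω M₁] [IsManifold I₂ ω M₂]
    [IsManifold I₃ ω M₃] {f : M₁ → M₂ → M₃} {g : M₁ → M₂} {p : M₃}
    (hp : ∀ x, f x (g x) = p) {x₀ : M₁}
    (hf : ContMDiffAt (I₁.prod I₂) I₃ ω (Function.uncurry f) (x₀, g x₀))
    (hg : ContMDiffAt I₁ I₂ ω g x₀) {v : (x : M₁) → TangentSpace I₂ (g x)}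
    (hv : ContMDiffAt I₁ I₂.tangent ω (fun x => (⟨g x, v x⟩ : TangentBundle I₂ M₂)) x₀) :
    ContMDiffAt I₁ 𝓘(ℂ, E₃) ω (fun x => modelDeriv I₂ I₃ (f x) (g x) (v x)) x₀ := by
  have : IsManifold I₂ 1 M₂ := IsManifold.of_le (n := ω) le_top
  have : IsManifold I₃ 1 M₃ := IsManifold.of_le (n := ω) le_top
  have h1 := ContMDiffAt.mfderiv (J := I₁) (I := I₂) (I' := I₃) (m := ω) (n := ω)
    f g hf hg (by simp)
  have hb : ContMDiffAt I₁ I₃ ω (fun x => f x (g x)) x₀ := by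
    simp only [hp]
    exact contMDiffAt_const
  have h2 := ContMDiffAt.clm_apply_of_inCoordinates
    (b₁ := g) (b₂ := fun x => f x (g x)) (E₁ := TangentSpace I₂) (E₂ := TangentSpace I₃)
    (ϕ := fun x => mfderiv I₂ I₃ (f x) (g x)) h1 hv hb
  have h3 := (Bundle.contMDiffAt_totalSpace.1 h2).2
  refine h3.congr_of_eventuallyEq (Filter.Eventually.of_forall fun x => ?_)
  exact (trivializationAt_apply_self ((hp x).trans (hp x₀).symm) _).symm

end Parametric

/-! ### Gauge transformations of automorphic systems -/

section Gauge

theorem rightInvariantField_sum_smul {E : Type*} [NormedAddCommGroup E] [NormedSpace ℂ E]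
    {G : Type*} [TopologicalSpace G] [ChartedSpace E G] [Group G]
    {ι : Type*} (s : Finset ι) (f : ι → ℂ) (A : ι → E) (g : G) :
    (∑ i ∈ s, f i • (rightInvariantField (A i : RightAlgebra E G) g : E)) =
      rightInvariantField (∑ i ∈ s, f i • A i : E) g := by
  change ∑ i ∈ s, f i • modelDeriv 𝓘(ℂ, E) 𝓘(ℂ, E) (fun a : G => a * g) 1 (A i) =
    modelDeriv 𝓘(ℂ, E) 𝓘(ℂ, E) (fun a : G => a * g) 1 (∑ i ∈ s, f i • A i)
  simp only [map_sum, map_smul]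

variable {S : Type*} [TopologicalSpace S] [ChartedSpace ℂ S]
  {E : Type*} [NormedAddCommGroup E] [NormedSpace ℂ E]
  {G : Type*} [TopologicalSpace G] [ChartedSpace E G] [Group G] [LieGroup 𝓘(ℂ, E) ω G]
  {F : Type*} [NormedAddCommGroup F] [NormedSpace ℂ F]
  {N : Type*} [TopologicalSpace N] [ChartedSpace F N]
  [MulAction G N] [ContMDiffSMul 𝓘(ℂ, E) 𝓘(ℂ, F) ω G N]

/-- The coefficient `(∂σ) σ⁻¹ + Ad_σ a` of the automorphic system into which the gauge
transformation `σ` takes the automorphic system with coefficient `a : S → T₁G`,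
for the derivation `∂` given by the vector field `d` on `S`. -/
def gaugeTransform (d : S → ℂ) (σ : S → G) (a : S → E) (t : S) : E :=
  modelDeriv 𝓘(ℂ, ℂ) 𝓘(ℂ, E) (fun r => σ r * (σ t)⁻¹) t (d t) +
    modelDeriv 𝓘(ℂ, E) 𝓘(ℂ, E) (fun c : G => σ t * c * (σ t)⁻¹) 1 (a t)

/-- The fundamental field of the transformed coefficient, at the transformed point, in any
`G`-space: it is used in `G` itself, and in the homogeneous space. -/
theorem modelDeriv_orbitMap_gaugeTransform (d : S → ℂ) {σ : S → G}
    (a : S → E) {t : S} (hσ : MDifferentiableAt 𝓘(ℂ, ℂ) 𝓘(ℂ, E) σ t) (y : N) :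
    modelDeriv 𝓘(ℂ, E) 𝓘(ℂ, F) (fun c : G => c • (σ t • y)) 1 (gaugeTransform d σ a t) =
      modelDeriv 𝓘(ℂ, ℂ) 𝓘(ℂ, F) (fun r => σ r • y) t (d t) +
        modelDeriv 𝓘(ℂ, F) 𝓘(ℂ, F) (fun z : N => σ t • z) y
          (modelDeriv 𝓘(ℂ, E) 𝓘(ℂ, F) (fun c : G => c • y) 1 (a t)) := by
  have hR : ∀ g : G, MDifferentiableAt 𝓘(ℂ, E) 𝓘(ℂ, E) (fun c : G => c * (σ t)⁻¹) g :=
    fun g => ((contMDiff_mul_right (I := 𝓘(ℂ, E)) (n := ω)).mdifferentiable (by simp)) g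
  have hL : MDifferentiableAt 𝓘(ℂ, E) 𝓘(ℂ, E) (fun c : G => σ t * c) 1 :=
    ((contMDiff_mul_left (I := 𝓘(ℂ, E)) (n := ω)).mdifferentiable (by simp)) 1
  -- `(σ r σ(t)⁻¹) • (σ t • y) = σ r • y` and `(σ t c σ(t)⁻¹) • (σ t • y) = σ t • (c • y)`
  rw [gaugeTransform, map_add]
  congr 1
  · rw [← modelDeriv_comp_apply (q := 1) (f := fun r => σ r * (σ t)⁻¹)
      (mdifferentiableAt_orbitMap _ _)
      ((hR _).comp t hσ) (by simp)]
    simp only [smul_smul, inv_mul_cancel_right]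
  · rw [← modelDeriv_comp_apply (q := 1) (f := fun c : G => σ t * c * (σ t)⁻¹)
      (mdifferentiableAt_orbitMap _ _) ((hR _).comp 1 hL) (by simp),
      ← modelDeriv_comp_apply (q := y) (f := fun c : G => c • y)
      (mdifferentiableAt_smul_const E F _ _)
      (mdifferentiableAt_orbitMap _ _) (by simp)]
    simp only [smul_smul, inv_mul_cancel_right]

theorem contMDiffAt_gaugeTransform [IsManifold 𝓘(ℂ, ℂ) ω S]
    {d : (t : S) → TangentSpace 𝓘(ℂ, ℂ) t}
    (hd : ContMDiff 𝓘(ℂ, ℂ) 𝓘(ℂ, ℂ).tangent ω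
      (fun t => (⟨t, d t⟩ : TangentBundle 𝓘(ℂ, ℂ) S)))
    {σ : S → G} {a : S → E} {t : S} (hσ : ContMDiffAt 𝓘(ℂ, ℂ) 𝓘(ℂ, E) ω σ t)
    (ha : ContMDiffAt 𝓘(ℂ, ℂ) 𝓘(ℂ, E) ω a t) :
    ContMDiffAt 𝓘(ℂ, ℂ) 𝓘(ℂ, E) ω (gaugeTransform d σ a) t := by
  have h1 : ContMDiffAt 𝓘(ℂ, ℂ) 𝓘(ℂ, E) ω
      (fun t => modelDeriv 𝓘(ℂ, ℂ) 𝓘(ℂ, E) (fun r => σ r * (σ t)⁻¹) t (d t)) t := by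
    refine contMDiffAt_modelDeriv_apply (f := fun t r => σ r * (σ t)⁻¹) (g := id) (p := 1)
      (fun t => mul_inv_cancel _) ?_ contMDiffAt_id (v := d) hd.contMDiffAt
    exact (ContMDiffAt.comp (t, t) (g := σ) hσ contMDiffAt_snd).mul
      (ContMDiffAt.comp (t, t) (g := σ) hσ contMDiffAt_fst).inv
  have h2 : ContMDiffAt 𝓘(ℂ, ℂ) 𝓘(ℂ, E) ω
      (fun t => modelDeriv 𝓘(ℂ, E) 𝓘(ℂ, E) (fun c : G => σ t * c * (σ t)⁻¹) 1 (a t)) t := by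
    refine contMDiffAt_modelDeriv_apply (f := fun t c => σ t * c * (σ t)⁻¹)
      (g := fun _ => (1 : G)) (p := 1) (fun t => by simp) ?_ contMDiffAt_const (v := a) ?_
    · have hσ' := ContMDiffAt.comp (I := 𝓘(ℂ, ℂ).prod 𝓘(ℂ, E)) (t, (1 : G)) (g := σ)
        (f := Prod.fst) hσ contMDiffAt_fst
      exact (hσ'.mul contMDiffAt_snd).mul hσ'.inv
    · have : IsManifold 𝓘(ℂ, E) 1 G := IsManifold.of_le (n := ω) le_top
      refine Bundle.contMDiffAt_totalSpace.2 ⟨contMDiffAt_const, ?_⟩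
      exact ha.congr_of_eventuallyEq (Filter.Eventually.of_forall fun t =>
        trivializationAt_apply_self rfl _)
  exact h1.add h2

/-- The gauge transformation `σ` takes the automorphic system with coefficient `a` to the one with
coefficient `gaugeTransform d σ a`. -/
theorem modelDeriv_gaugeMap (d : S → ℂ) {σ : S → G} (a : S → E) {t : S}
    (hσ : MDifferentiableAt 𝓘(ℂ, ℂ) 𝓘(ℂ, E) σ t) (τ : G) :
    modelDeriv (𝓘(ℂ, ℂ).prod 𝓘(ℂ, E)) (𝓘(ℂ, ℂ).prod 𝓘(ℂ, E)) (gaugeMap σ) (t, τ)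
      (d t, modelDeriv 𝓘(ℂ, E) 𝓘(ℂ, E) (fun c : G => c * τ) 1 (a t)) =
      (d t, modelDeriv 𝓘(ℂ, E) 𝓘(ℂ, E) (fun c : G => c * (σ t * τ)) 1
        (gaugeTransform d σ a t)) := by
  have hmul : MDifferentiableAt (𝓘(ℂ, ℂ).prod 𝓘(ℂ, E)) 𝓘(ℂ, E)
      (fun p : S × G => σ p.1 * p.2) (t, τ) := by
    have h1 : MDifferentiableAt (𝓘(ℂ, ℂ).prod 𝓘(ℂ, E)) (𝓘(ℂ, E).prod 𝓘(ℂ, E))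
        (fun p : S × G => (σ p.1, p.2)) (t, τ) :=
      (hσ.comp (t, τ) mdifferentiableAt_fst).prodMk mdifferentiableAt_snd
    exact ((contMDiff_mul 𝓘(ℂ, E) ω).mdifferentiable (by simp) (σ t, τ)).comp (t, τ) h1
  have h := DFunLike.congr_fun (mfderiv_prodMk mdifferentiableAt_fst hmul)
    (d t, modelDeriv 𝓘(ℂ, E) 𝓘(ℂ, E) (fun c : G => c * τ) 1 (a t))
  refine h.trans (Prod.ext ?_ ?_)
  · change mfderiv (𝓘(ℂ, ℂ).prod 𝓘(ℂ, E)) 𝓘(ℂ, ℂ) (Prod.fst : S × G → S) (t, τ) _ = _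
    rw [mfderiv_fst]
    rfl
  · refine (mfderiv_prod_eq_add_apply hmul).trans ?_
    exact (modelDeriv_orbitMap_gaugeTransform (F := E) (N := G) d a hσ τ).symm

/-- If `σ` takes the solution `x` to the constant `x₀`, then the transformed coefficient is killed
by the derivative of the orbit map of `x₀`. -/
theorem modelDeriv_orbitMap_gaugeTransform_eq_zero {d : S → ℂ}
    {σ : S → G} {a : S → E} {x : S → N} {x₀ : N} {t : S}
    (hσ : MDifferentiableAt 𝓘(ℂ, ℂ) 𝓘(ℂ, E) σ t) (hx : MDifferentiableAt 𝓘(ℂ, ℂ) 𝓘(ℂ, F) x t)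
    (hσx : ∀ᶠ r in 𝓝 t, σ r • x r = x₀)
    (hsol : modelDeriv 𝓘(ℂ, ℂ) 𝓘(ℂ, F) x t (d t) =
      modelDeriv 𝓘(ℂ, E) 𝓘(ℂ, F) (fun c : G => c • x t) 1 (a t)) :
    modelDeriv 𝓘(ℂ, E) 𝓘(ℂ, F) (fun c : G => c • x₀) 1 (gaugeTransform d σ a t) = 0 := by
  have h := modelDeriv_orbitMap_gaugeTransform (F := F) d a hσ (x t)
  rw [hσx.self_of_nhds, ← hsol] at h
  rw [h]
  have hunc : MDifferentiableAt (𝓘(ℂ, ℂ).prod 𝓘(ℂ, F)) 𝓘(ℂ, F)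
      (Function.uncurry fun r y => σ r • y) (t, x t) := by
    have h1 : MDifferentiableAt (𝓘(ℂ, ℂ).prod 𝓘(ℂ, F)) (𝓘(ℂ, E).prod 𝓘(ℂ, F))
        (fun p : S × N => (σ p.1, p.2)) (t, x t) :=
      (hσ.comp (t, x t) mdifferentiableAt_fst).prodMk mdifferentiableAt_snd
    exact ((ContMDiffSMul.contMDiff_smul (I := 𝓘(ℂ, E)) (n := ω)).mdifferentiable (by simp)
      (σ t, x t)).comp (t, x t) h1
  -- the two terms are the partial derivatives of `σ r • x r'` on the diagonal, where it is constant
  refine (modelDeriv_diag_apply (f := fun r y => σ r • y) hunc hx (d t)).symm.trans ?_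
  have hconst : modelDeriv 𝓘(ℂ, ℂ) 𝓘(ℂ, F) (fun r => σ r • x r) t = 0 :=
    (Filter.EventuallyEq.mfderiv_eq (f := fun _ => x₀) hσx).trans mfderiv_const
  rw [hconst]
  rfl

end Gauge

end LieVessiot

end

/-! ### Reduction of an automorphic system by a solution -/

theorem mainTheorem1
    {S : Type*} [TopologicalSpace S] [T2Space S] [ChartedSpace ℂ S] [IsManifold 𝓘(ℂ, ℂ) ω S]
    (d : (t : S) → TangentSpace 𝓘(ℂ, ℂ) t)
    (hd : ContMDiff 𝓘(ℂ, ℂ) 𝓘(ℂ, ℂ).tangent ω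
      (fun t => (⟨t, d t⟩ : TangentBundle 𝓘(ℂ, ℂ) S)))
    {E : Type*} [NormedAddCommGroup E] [NormedSpace ℂ E] [FiniteDimensional ℂ E]
    {G : Type*} [TopologicalSpace G] [T2Space G] [ConnectedSpace G] [ChartedSpace E G] [Group G]
    [IsTopologicalGroup G] [LieGroup 𝓘(ℂ, E) ω G]
    {F : Type*} [NormedAddCommGroup F] [NormedSpace ℂ F] [FiniteDimensional ℂ F]
    {M : Type*} [TopologicalSpace M] [T2Space M] [ChartedSpace F M] [IsManifold 𝓘(ℂ, F) ω M]
    [MulAction G M] [ContMDiffSMul 𝓘(ℂ, E) 𝓘(ℂ, F) ω G M] [MulAction.IsPretransitive G M]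
    (x₀ : M)
    (A : LieVessiot.AutomorphicSystem E G (Set.univ : Set S))
    (t₀ : S) (U : Set S) (hU : IsOpen U) (ht₀ : t₀ ∈ U) (x : S → M)
    (hx : LieVessiot.IsSolutionOn d (A.inducedField d F M) x U) :
    ∃ S' : Set S, IsOpen S' ∧ t₀ ∈ S' ∧ S' ⊆ U ∧
      ∃ σ : S → G, ContMDiffOn 𝓘(ℂ, ℂ) 𝓘(ℂ, E) ω σ S' ∧
        (∀ t ∈ S', LieVessiot.gaugeMap σ (t, x t) = (t, x₀)) ∧
        ∃ B : LieVessiot.AutomorphicSystem E G S',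
          B.IsIn (LieVessiot.identityComponent (MulAction.stabilizer G x₀)) ∧
          LieVessiot.GaugeMapsOn σ S' (A.field d) (B.field d) := by
  -- the coefficient of `A`, as a holomorphic function with values in the model space of `T₁G`
  let v : Fin A.s → E := A.A
  let a : S → E := fun t => ∑ i, A.f i t • v i
  have ha : ∀ t, ContMDiffAt 𝓘(ℂ, ℂ) 𝓘(ℂ, E) ω a t := fun t =>
    ContMDiffAt.sum fun i _ =>
      (ContinuousLinearMap.toSpanSingleton ℂ (v i)).contMDiff.contMDiffAt.comp t
        ((A.holomorphic i).contMDiffAt Filter.univ_mem)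
  -- a holomorphic section of an orbit map near `x t₀`
  obtain ⟨g₀, hg₀⟩ := MulAction.exists_smul_eq G x₀ (x t₀)
  obtain ⟨s, hs, -, hsec⟩ := LieVessiot.exists_contMDiffAt_section
    (LieVessiot.contMDiff_orbitMap (E := E) (F := F) x₀).contMDiffAt
    (LieVessiot.surjective_modelDeriv_orbitMap (E := E) (F := F) x₀ g₀)
  simp only [hg₀] at hs hsec
  have hs' : ∀ᶠ y in nhds (x t₀), ContMDiffAt 𝓘(ℂ, F) 𝓘(ℂ, E) ω s y ∧ s y • x₀ = y :=
    ((contMDiffAt_iff_contMDiffAt_nhds (by simp)).1 hs).and hsec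
  obtain ⟨V, hV, hVo, hxV⟩ := eventually_nhds_iff.1 hs'
  have hS'o : IsOpen (U ∩ x ⁻¹' V) := hx.1.continuousOn.isOpen_inter_preimage hU hVo
  set S' := U ∩ x ⁻¹' V with hS'
  let σ : S → G := fun t => (s (x t))⁻¹
  have hxd : ∀ t ∈ S', ContMDiffAt 𝓘(ℂ, ℂ) 𝓘(ℂ, F) ω x t := fun t ht =>
    (hx.1 t ht.1).contMDiffAt (hU.mem_nhds ht.1)
  have hσ : ∀ t ∈ S', ContMDiffAt 𝓘(ℂ, ℂ) 𝓘(ℂ, E) ω σ t := fun t ht =>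
    (ContMDiffAt.comp t (hV (x t) ht.2).1 (hxd t ht)).inv
  have hσd : ∀ t ∈ S', MDifferentiableAt 𝓘(ℂ, ℂ) 𝓘(ℂ, E) σ t := fun t ht =>
    (hσ t ht).mdifferentiableAt (by simp)
  have hσx : ∀ t ∈ S', σ t • x t = x₀ := fun t ht => by
    rw [inv_smul_eq_iff]
    exact (hV (x t) ht.2).2.symm
  -- the transformed coefficient takes its values in the Lie algebra of the isotropy subgroup
  let b : S → E := LieVessiot.gaugeTransform d σ a
  have hb : ∀ t ∈ S', ContMDiffAt 𝓘(ℂ, ℂ) 𝓘(ℂ, E) ω b t := fun t ht =>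
    LieVessiot.contMDiffAt_gaugeTransform hd (hσ t ht) (ha t)
  have hsol : ∀ t ∈ S', LieVessiot.modelDeriv 𝓘(ℂ, ℂ) 𝓘(ℂ, F) x t (d t) =
      LieVessiot.modelDeriv 𝓘(ℂ, E) 𝓘(ℂ, F) (fun c : G => c • x t) 1 (a t) := by
    intro t ht
    have h1 := DFunLike.congr_fun (mfderiv_prodMk (I := 𝓘(ℂ, ℂ)) (I' := 𝓘(ℂ, ℂ)) (I'' := 𝓘(ℂ, F))
      (mdifferentiableAt_id (x := t)) ((hxd t ht).mdifferentiableAt (by simp))) (d t)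
    have h2 := congrArg Prod.snd (h1.symm.trans (hx.2 t ht.1))
    refine Eq.trans h2 ?_
    change ∑ i, A.f i t • LieVessiot.modelDeriv 𝓘(ℂ, E) 𝓘(ℂ, F)
      (fun c : G => c • x t) 1 (v i) = _
    simp only [a, map_sum, map_smul]
  set D := LieVessiot.modelDeriv 𝓘(ℂ, E) 𝓘(ℂ, F) (fun c : G => c • x₀) 1 with hD
  have hbD : ∀ t ∈ S', D (b t) = 0 := fun t ht =>
    LieVessiot.modelDeriv_orbitMap_gaugeTransform_eq_zero (hσd t ht)
      ((hxd t ht).mdifferentiableAt (by simp))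
      (Filter.eventually_of_mem (hS'o.mem_nhds ht) hσx) (hsol t ht)
  -- coordinates in a basis of this Lie algebra
  obtain ⟨P, hP⟩ := LinearMap.exists_leftInverse_of_injective D.ker.subtype
    (Submodule.ker_subtype _)
  let B := Module.finBasis ℂ D.ker
  let coordinate : Fin (Module.finrank ℂ D.ker) → E →L[ℂ] ℂ := fun j =>
    LinearMap.toContinuousLinearMap (B.coord j ∘ₗ P)
  have hsum : ∀ t ∈ S', ∑ j, coordinate j (b t) • (B j : E) = b t := by
    intro t ht
    have h1 : P (b t) = ⟨b t, hbD t ht⟩ := LinearMap.congr_fun hP ⟨b t, hbD t ht⟩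
    have h2 := congrArg D.ker.subtype (B.sum_repr (P (b t)))
    rw [map_sum] at h2
    refine Eq.trans (Finset.sum_congr rfl fun j _ => ?_) (h2.trans (congrArg D.ker.subtype h1))
    simp [coordinate]
  refine ⟨S', hS'o, ⟨ht₀, hxV⟩, Set.inter_subset_left, σ,
    fun t ht => (hσ t ht).contMDiffWithinAt, fun t ht => Prod.ext rfl (hσx t ht),
    ⟨Module.finrank ℂ D.ker, fun j t => coordinate j (b t), fun j => (B j : E), fun j t ht =>
      ((coordinate j).contMDiff.contMDiffAt.comp t (hb t ht)).contMDiffWithinAt⟩,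
    fun j => LieVessiot.mem_subgroupAlgebra_identityComponent_stabilizer (E := E) (F := F)
      x₀ (B j).2, ?_⟩
  rintro ⟨t, τ⟩ ht
  have h1 : ∑ i, A.f i t • (LieVessiot.rightInvariantField (A.A i) τ : E) =
      LieVessiot.modelDeriv 𝓘(ℂ, E) 𝓘(ℂ, E) (fun c : G => c * τ) 1 (a t) :=
    LieVessiot.rightInvariantField_sum_smul (E := E) (G := G) Finset.univ (fun i => A.f i t) v τ
  have h2 : LieVessiot.modelDeriv 𝓘(ℂ, E) 𝓘(ℂ, E) (fun c : G => c * (σ t * τ)) 1 (b t) =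
      ∑ j, coordinate j (b t) •
        (LieVessiot.rightInvariantField (B j : E) (σ t * τ) : E) := by
    refine Eq.trans ?_ (LieVessiot.rightInvariantField_sum_smul (E := E) (G := G)
      Finset.univ (fun j => coordinate j (b t)) (fun j => (B j : E)) (σ t * τ)).symm
    rw [hsum t ht]
    rfl
  have h3 := LieVessiot.modelDeriv_gaugeMap d a (hσd t ht) τ
  rw [← h1] at h3
  exact h3.trans (Prod.ext rfl h2)
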